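/- Let $n\ge 3$, let $G=K_n$ be the complete graph of order $n$, let $G_1,G_2$ be two disjoint copies of $G$ and let $g:V(G_1)\to V(G_2)$ be a function. The functigraph $F_G$ has vertex set $V(G_1)\cup V(G_2)$ and edge set $E(G_1)\cup E(G_2)\cup\{uv : u\in V(G_1),\ v\in V(G_2),\ g(u)=v\}$. The distinguishing number $\mathrm{Dist}(H)$ of a finite graph $H$ is the least $t$ for which there is a labeling $V(H)\to\{1,\dots,t\}$ that is preserved by no non-trivial automorphism of $H$. Let $I=g(V(G_1))$ and $s=|I|$, let $l=\max_{v\in I}|g^{-1}(v)|$ be the largest fibre size, and let $m$ be the number of $v\in I$ with exactly one preimage under $g$. For an integer $m\ge 0$ let $\psi(m)$ be the least integer $k\ge 0$ with $m\le 2\binom{k}{2}+k=k^2$. If $1<s\le n-1$, then $\mathrm{Dist}(F_G)=n-s$, or $\mathrm{Dist}(F_G)=n-s+1$, or $m\ge 2$ and $\mathrm{Dist}(F_G)=\psi(m)$. More precisely, $$\mathrm{Dist}(F_G)=\begin{cases}\max\{n-s+1,\psi(m)\} & \text{if } l=n-s+1,\\ \max\{n-s,\psi(m)\} & \text{if } l\ne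 n-s+1.\end{cases}$$ -/

import Mathlib

/-- The functigraph `F_G` of a graph `G` with respect to `g`: two disjoint copies of `G`
(the left summand is the first copy, the right summand the second one), together with an edge
from each vertex `u` of the first copy to the vertex `g u` of the second copy. -/
def functigraph {V : Type*} (G : SimpleGraph V) (g : V → V) : SimpleGraph (V ⊕ V) where
  Adj
    | Sum.inl u, Sum.inl v => G.Adj u v
    | Sum.inr u, Sum.inr v => G.Adj u v
    | Sum.inl u, Sum.inr v => g u = v
    | Sum.inr v, Sum.inl u => g u = v
  symm := ⟨by
    rintro (u | u) (v | v) h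
    · exact G.adj_symm h
    · exact h
    · exact h
    · exact G.adj_symm h⟩
  loopless := ⟨by
    rintro (u | u) h
    · exact G.loopless.irrefl u h
    · exact G.loopless.irrefl u h⟩

/-- A vertex labeling is distinguishing if no non-trivial automorphism preserves the labels. -/
def IsDistinguishing {W L : Type*} (H : SimpleGraph W) (f : W → L) : Prop :=
  ∀ φ : H ≃g H, (∀ w, f (φ w) = f w) → ∀ w, φ w = w

/-- The distinguishing number: the least `t` such that there is a distinguishing labeling with
`t` labels. (Such a `t` exists for every graph with finitely many vertices.) -/
noncomputable def distinguishingNumber {W : Type*} (H : SimpleGraph W) : ℕ :=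
  sInf {t : ℕ | ∃ f : W → Fin t, IsDistinguishing H f}

/-- `ψ(m)`: the least `k` such that `m ≤ 2 * (k choose 2) + k`. -/
noncomputable def psi (m : ℕ) : ℕ := sInf {k : ℕ | m ≤ 2 * k.choose 2 + k}

section Fibres

variable {V : Type*} [Fintype V] [DecidableEq V]

/-- The image of `g`, as a finite set. -/
def imageSet (g : V → V) : Finset V := Finset.univ.image g

/-- The number of vertices that `g` maps to `v`. -/
def fibreSize (g : V → V) (v : V) : ℕ := (Finset.univ.filter fun u => g u = v).card

/-- The largest size of a fibre over a vertex of the image. -/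
def maxFibreSize (g : V → V) : ℕ := (imageSet g).sup (fibreSize g)

/-- The number of vertices in the image that have exactly one preimage. -/
def singletonFibres (g : V → V) : ℕ := ((imageSet g).filter fun v => fibreSize g v = 1).card

end Fibres

open Finset

/-! Everything reduces to `Dist = max (n - s) l (ψ m)`. Lower bound (`IsDistinguishing.bounds`):
transposing two points outside the image, two points of one fibre, or two singleton fibres together
with their images is an automorphism, so these need distinct labels, respectively distinct pairs of
labels. Upper bound: as `g` is neither onto nor constant, the vertices whose neighbourhood is a
clique are exactly the points of the second copy outside the image. Hence every automorphism
preserves both copies and is a pair `(σ, τ)` intertwined by `g`; `τ` preserves fibre sizes, so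
labels need only separate points within each size class. Finally `l ≤ n - s + 1`, so `l` matters
only when equality holds. -/

theorem exists_injOn_of_card_le {α β : Type*} [DecidableEq α] [Fintype β] [Nonempty β]
    (S : Finset α) (h : S.card ≤ Fintype.card β) : ∃ f : α → β, Set.InjOn f S := by
  obtain ⟨e⟩ : Nonempty (S ↪ β) := Function.Embedding.nonempty_of_card_le (by simpa using h)
  refine ⟨fun a => if ha : a ∈ S then e ⟨a, ha⟩ else Classical.arbitrary β, ?_⟩
  intro a ha b hb hab
  have ha' : a ∈ S := ha
  have hb' : b ∈ S := hb
  simp only [ha', hb', dif_pos] at hab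
  simpa using e.injective hab

theorem two_mul_choose_two_add_self (k : ℕ) : 2 * k.choose 2 + k = k * k := by
  induction k with
  | zero => simp
  | succ k ih =>
    have : (k + 1).choose 2 = k + k.choose 2 := by simp [Nat.choose_succ_succ' k 1]
    rw [this]
    linarith

theorem psi_le_iff (m k : ℕ) : psi m ≤ k ↔ m ≤ k * k := by
  have hset : {k : ℕ | m ≤ 2 * k.choose 2 + k} = {k : ℕ | m ≤ k * k} := by
    simp only [two_mul_choose_two_add_self]
  unfold psi
  rw [hset]
  constructor
  · intro h
    have hmem : sInf {k : ℕ | m ≤ k * k} ∈ {k : ℕ | m ≤ k * k} :=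
      Nat.sInf_mem ⟨m, Nat.le_mul_self m⟩
    exact le_trans hmem (Nat.mul_le_mul h h)
  · exact fun h => Nat.sInf_le h

/-! ### Automorphisms of the functigraph of a complete graph -/

section Automorphisms

variable {V : Type*} {g : V → V}

/-- A pair of permutations commuting with `g` induces an automorphism of the functigraph of the
complete graph. -/
def functigraphTopIso (σ τ : Equiv.Perm V) (h : ∀ u, g (σ u) = τ (g u)) :
    functigraph (⊤ : SimpleGraph V) g ≃g functigraph (⊤ : SimpleGraph V) g where
  toEquiv := Equiv.sumCongr σ τ
  map_rel_iff' := by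
    rintro (u | u) (v | v) <;> simp [functigraph, h]

theorem IsDistinguishing.perm_eq {L : Type*} {f : V ⊕ V → L}
    (hf : IsDistinguishing (functigraph (⊤ : SimpleGraph V) g) f) (σ τ : Equiv.Perm V)
    (h : ∀ u, g (σ u) = τ (g u)) (hσ : ∀ u, f (Sum.inl (σ u)) = f (Sum.inl u))
    (hτ : ∀ v, f (Sum.inr (τ v)) = f (Sum.inr v)) : (∀ u, σ u = u) ∧ ∀ v, τ v = v := by
  have key := hf (functigraphTopIso σ τ h) (by
    rintro (u | v)
    · exact hσ u
    · exact hτ v)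
  exact ⟨fun u => Sum.inl_injective (key (Sum.inl u)),
    fun v => Sum.inr_injective (key (Sum.inr v))⟩

theorem IsDistinguishing.injOn_fibre [DecidableEq V] {L : Type*} {f : V ⊕ V → L}
    (hf : IsDistinguishing (functigraph (⊤ : SimpleGraph V) g) f) {u u' : V} (hg : g u = g u')
    (h : f (Sum.inl u) = f (Sum.inl u')) : u = u' := by
  have key := (hf.perm_eq (Equiv.swap u u') 1
    (fun x => by
      rw [Equiv.swap_apply_def]
      split_ifs with h1 h2 <;> simp_all)
    (fun x => by
      rw [Equiv.swap_apply_def]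
      split_ifs with h1 h2 <;> simp_all) (fun _ => rfl)).1 u'
  simpa using key

theorem IsDistinguishing.injOn_compl_range [DecidableEq V] {L : Type*} {f : V ⊕ V → L}
    (hf : IsDistinguishing (functigraph (⊤ : SimpleGraph V) g) f) {v v' : V}
    (hv : ∀ u, g u ≠ v) (hv' : ∀ u, g u ≠ v')
    (h : f (Sum.inr v) = f (Sum.inr v')) : v = v' := by
  have key := (hf.perm_eq 1 (Equiv.swap v v')
    (fun x => (Equiv.swap_apply_of_ne_of_ne (hv x) (hv' x)).symm) (fun _ => rfl)
    (fun x => by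
      rw [Equiv.swap_apply_def]
      split_ifs with h1 h2 <;> simp_all)).2 v'
  simpa using key

/-- Having a clique as neighbourhood is invariant under automorphisms. It fails at `inl u`, which
sees `inr (g u)` and some `inl v` with `g v ≠ g u`, and at `inr (g u)`, which sees `inl u` and some
other `inr v`. -/
theorem map_inr_of_notMem_range {w : V} (hw : ∀ u, g u ≠ w) (hne : ∃ u u', g u ≠ g u')
    (φ : functigraph (⊤ : SimpleGraph V) g ≃g functigraph (⊤ : SimpleGraph V) g) :
    ∃ y, φ (Sum.inr w) = Sum.inr y ∧ ∀ u, g u ≠ y := by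
  have hclique : ∀ a b, (functigraph ⊤ g).Adj (Sum.inr w) a →
      (functigraph ⊤ g).Adj (Sum.inr w) b → a ≠ b → (functigraph ⊤ g).Adj a b := by
    rintro (a | a) (b | b) ha hb hab
    · exact absurd ha (hw a)
    · exact absurd ha (hw a)
    · exact absurd hb (hw b)
    · exact fun h => hab (congrArg _ h)
  have himage : ∀ a b, (functigraph ⊤ g).Adj (φ (Sum.inr w)) a →
      (functigraph ⊤ g).Adj (φ (Sum.inr w)) b → a ≠ b → (functigraph ⊤ g).Adj a b := by
    intro a b ha hb hab
    have ha' : (functigraph ⊤ g).Adj (Sum.inr w) (φ.symm a) := by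
      rw [← φ.map_adj_iff]; simpa using ha
    have hb' : (functigraph ⊤ g).Adj (Sum.inr w) (φ.symm b) := by
      rw [← φ.map_adj_iff]; simpa using hb
    exact φ.symm.map_adj_iff.1 (hclique _ _ ha' hb' fun h => hab (φ.symm.injective h))
  rcases hφ : φ (Sum.inr w) with u | y
  · exfalso
    rw [hφ] at himage
    obtain ⟨v, hv⟩ : ∃ v, g v ≠ g u := by
      by_contra! hcon
      obtain ⟨a, b, hab⟩ := hne
      exact hab ((hcon a).trans (hcon b).symm)
    have hvu : u ≠ v := fun h => hv (congrArg g h.symm)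
    exact hv (himage (Sum.inl v) (Sum.inr (g u)) hvu rfl (by simp))
  · refine ⟨y, rfl, fun u hu => ?_⟩
    rw [hφ] at himage
    obtain ⟨v, hv⟩ : ∃ v, v ≠ y := by
      by_contra! hcon
      obtain ⟨a, b, hab⟩ := hne
      exact hab ((hcon _).trans (hcon _).symm)
    have huv : g u = v := himage (Sum.inl u) (Sum.inr v) hu hv.symm (by simp)
    exact hv (huv.symm.trans hu)

theorem exists_map_inr {w : V} (hw : ∀ u, g u ≠ w) (hne : ∃ u u', g u ≠ g u')
    (φ : functigraph (⊤ : SimpleGraph V) g ≃g functigraph (⊤ : SimpleGraph V) g) (v : V) :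
    ∃ y, φ (Sum.inr v) = Sum.inr y := by
  obtain ⟨y, hy, hyg⟩ := map_inr_of_notMem_range hw hne φ
  by_cases hvw : v = w
  · exact ⟨y, hvw ▸ hy⟩
  -- The image of `inr w` has no neighbour in the first copy.
  · have hadj : (functigraph (⊤ : SimpleGraph V) g).Adj (φ (Sum.inr v)) (φ (Sum.inr w)) :=
      φ.map_adj_iff.2 hvw
    rw [hy] at hadj
    rcases hv : φ (Sum.inr v) with u | x
    · rw [hv] at hadj
      exact absurd hadj (hyg u)
    · exact ⟨x, rfl⟩

theorem exists_map_inl {w : V} (hw : ∀ u, g u ≠ w) (hne : ∃ u u', g u ≠ g u')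
    (φ : functigraph (⊤ : SimpleGraph V) g ≃g functigraph (⊤ : SimpleGraph V) g) (u : V) :
    ∃ x, φ (Sum.inl u) = Sum.inl x := by
  rcases hu : φ (Sum.inl u) with x | y
  · exact ⟨x, rfl⟩
  · obtain ⟨z, hz⟩ := exists_map_inr hw hne φ.symm y
    rw [← hu] at hz
    simp at hz

end Automorphisms

/-! ### Fibre counts and the resulting bounds -/

section Counting

variable {V : Type*} [Fintype V] [DecidableEq V] (g : V → V)

theorem mem_imageSet {v : V} : v ∈ imageSet g ↔ ∃ u, g u = v := by
  simp [imageSet]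

theorem fibreSize_pos_iff {v : V} : 0 < fibreSize g v ↔ ∃ u, g u = v := by
  simp [fibreSize, Finset.card_pos, Finset.Nonempty]

theorem sum_fibreSize : ∑ v ∈ imageSet g, fibreSize g v = Fintype.card V :=
  (Finset.card_eq_sum_card_fiberwise (s := univ) (t := imageSet g) (f := g)
    (fun u _ => (mem_imageSet g).2 ⟨u, rfl⟩)).symm

/-- The excesses `fibreSize g v - 1` over the image sum to `n - s`, and each large fibre contributes
at least 1. Thus `n - s` labels already separate the images of large fibres, which impose no further
condition. -/
theorem card_largeFibres_add_card_imageSet_le :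
    #{v | 2 ≤ fibreSize g v} + #(imageSet g) ≤ Fintype.card V := by
  have hsub : ({v | 2 ≤ fibreSize g v} : Finset V) = {v ∈ imageSet g | 2 ≤ fibreSize g v} := by
    ext v
    simp only [mem_filter, mem_univ, true_and, iff_and_self, mem_imageSet, ← fibreSize_pos_iff]
    omega
  rw [← sum_fibreSize g, hsub, card_filter, card_eq_sum_ones, ← sum_add_distrib]
  refine sum_le_sum fun v hv => ?_
  have := (fibreSize_pos_iff g).2 ((mem_imageSet g).1 hv)
  split_ifs <;> omega

theorem maxFibreSize_le_iff {k : ℕ} : maxFibreSize g ≤ k ↔ ∀ v, fibreSize g v ≤ k := by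
  simp only [maxFibreSize, Finset.sup_le_iff]
  refine ⟨fun h v => ?_, fun h v _ => h v⟩
  by_cases hv : v ∈ imageSet g
  · exact h v hv
  · rw [mem_imageSet, ← fibreSize_pos_iff] at hv
    omega

/-- The other `s - 1` fibres each use at least one vertex. -/
theorem maxFibreSize_add_card_imageSet_le [Nonempty V] :
    maxFibreSize g + #(imageSet g) ≤ Fintype.card V + 1 := by
  have hpos : ∀ v ∈ imageSet g, 1 ≤ fibreSize g v := fun v hv =>
    (fibreSize_pos_iff g).2 ((mem_imageSet g).1 hv)
  have hs : #(imageSet g) ≤ Fintype.card V := card_le_univ _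
  suffices h : maxFibreSize g ≤ Fintype.card V + 1 - #(imageSet g) by omega
  refine Finset.sup_le fun v hv => ?_
  have h1 := Finset.add_sum_erase _ (fibreSize g) hv
  have h2 : #((imageSet g).erase v) ≤ ∑ x ∈ (imageSet g).erase v, fibreSize g x := by
    rw [card_eq_sum_ones]
    exact sum_le_sum fun x hx => hpos x (mem_of_mem_erase hx)
  rw [sum_fibreSize] at h1
  have h3 := card_erase_add_one hv
  omega

theorem singletonFibres_eq : singletonFibres g = #{v | fibreSize g v = 1} := by
  unfold singletonFibres
  congr 1
  ext v
  simp only [mem_filter, mem_univ, true_and, and_iff_right_iff_imp, mem_imageSet,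
    ← fibreSize_pos_iff]
  omega

theorem card_fibreSize_eq_zero : #{v | fibreSize g v = 0} = Fintype.card V - #(imageSet g) := by
  rw [← card_compl]
  congr 1
  ext v
  simp only [mem_filter, mem_univ, true_and, mem_compl, mem_imageSet, ← fibreSize_pos_iff]
  omega

theorem eq_of_fibreSize_eq_one {u u' : V} (h : fibreSize g (g u) = 1) (hu : g u' = g u) :
    u' = u :=
  Finset.card_le_one.1 h.le u' (by simp [hu]) u (by simp)

theorem IsDistinguishing.injOn_singleton {L : Type*} {f : V ⊕ V → L}
    (hf : IsDistinguishing (functigraph (⊤ : SimpleGraph V) g) f) {u u' : V}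
    (hu : fibreSize g (g u) = 1) (hu' : fibreSize g (g u') = 1)
    (h : f (Sum.inl u) = f (Sum.inl u')) (h' : f (Sum.inr (g u)) = f (Sum.inr (g u'))) :
    u = u' := by
  have key := (hf.perm_eq (Equiv.swap u u') (Equiv.swap (g u) (g u'))
    (fun x => by
      by_cases h1 : x = u
      · simp [h1]
      by_cases h2 : x = u'
      · simp [h2]
      rw [Equiv.swap_apply_of_ne_of_ne h1 h2, Equiv.swap_apply_of_ne_of_ne
        (fun e => h1 (eq_of_fibreSize_eq_one g hu e))
        (fun e => h2 (eq_of_fibreSize_eq_one g hu' e))])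
    (fun x => by
      rw [Equiv.swap_apply_def]
      split_ifs with h1 h2 <;> simp_all)
    (fun x => by
      rw [Equiv.swap_apply_def]
      split_ifs with h1 h2 <;> simp_all)).1 u'
  simpa using key

theorem IsDistinguishing.bounds {k : ℕ} {f : V ⊕ V → Fin k}
    (hf : IsDistinguishing (functigraph (⊤ : SimpleGraph V) g) f) :
    Fintype.card V - #(imageSet g) ≤ k ∧ maxFibreSize g ≤ k ∧ singletonFibres g ≤ k * k := by
  refine ⟨?_, ?_, ?_⟩
  · rw [← card_fibreSize_eq_zero]
    have := Finset.card_le_card_of_injOn (s := {v | fibreSize g v = 0}) (t := univ)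
      (fun v => f (Sum.inr v)) (fun _ _ => mem_coe.2 (mem_univ _)) (by
        intro v hv v' hv' h
        simp only [coe_filter, mem_univ, true_and, Set.mem_ofPred_eq] at hv hv'
        exact hf.injOn_compl_range
          (fun u hu => (fibreSize_pos_iff g |>.2 ⟨u, hu⟩).ne' hv)
          (fun u hu => (fibreSize_pos_iff g |>.2 ⟨u, hu⟩).ne' hv') h)
    simpa using this
  · rw [maxFibreSize_le_iff]
    intro v
    have := Finset.card_le_card_of_injOn (s := {u | g u = v}) (t := univ)
      (fun u => f (Sum.inl u)) (fun _ _ => mem_coe.2 (mem_univ _)) (by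
        intro u hu u' hu' h
        simp only [coe_filter, mem_univ, true_and, Set.mem_ofPred_eq] at hu hu'
        exact hf.injOn_fibre (hu.trans hu'.symm) h)
    simpa [fibreSize] using this
  · have hle : singletonFibres g ≤ #{u | fibreSize g (g u) = 1} := by
      rw [singletonFibres_eq]
      refine le_trans (card_le_card fun v hv => ?_) (card_image_le (f := g))
      simp only [mem_filter, mem_univ, true_and] at hv
      obtain ⟨u, rfl⟩ := (fibreSize_pos_iff g).1 (hv ▸ Nat.one_pos)
      exact mem_image_of_mem g (by simpa using hv)
    refine hle.trans ?_
    have := Finset.card_le_card_of_injOn (s := {u | fibreSize g (g u) = 1}) (t := univ)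
      (fun u => (f (Sum.inl u), f (Sum.inr (g u)))) (fun _ _ => mem_coe.2 (mem_univ _)) (by
        intro u hu u' hu' h
        simp only [coe_filter, mem_univ, true_and, Set.mem_ofPred_eq] at hu hu'
        exact hf.injOn_singleton g hu hu' (congrArg Prod.fst h) (congrArg Prod.snd h))
    simpa using this

variable {g}

/-! ### Construction of a labeling and the value of the distinguishing number -/

theorem isDistinguishing_of_injOn {L : Type*} {f : V ⊕ V → L} {w : V} (hw : ∀ u, g u ≠ w)
    (hne : ∃ u u', g u ≠ g u')
    (hzero : ∀ v v', fibreSize g v = 0 → fibreSize g v' = 0 →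
      f (Sum.inr v) = f (Sum.inr v') → v = v')
    (hone : ∀ u u', fibreSize g (g u) = 1 → fibreSize g (g u') = 1 →
      f (Sum.inl u) = f (Sum.inl u') → f (Sum.inr (g u)) = f (Sum.inr (g u')) → g u = g u')
    (hlarge : ∀ v v', 2 ≤ fibreSize g v → 2 ≤ fibreSize g v' →
      f (Sum.inr v) = f (Sum.inr v') → v = v')
    (hfibre : ∀ u u', g u = g u' → f (Sum.inl u) = f (Sum.inl u') → u = u') :
    IsDistinguishing (functigraph (⊤ : SimpleGraph V) g) f := by
  intro φ hφ
  choose τ hτ using exists_map_inr hw hne φ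
  choose σ hσ using exists_map_inl hw hne φ
  have hcomm : ∀ u v, g u = v ↔ g (σ u) = τ v := by
    intro u v
    have := φ.map_adj_iff (v := Sum.inl u) (w := Sum.inr v)
    rw [hσ, hτ] at this
    exact this.symm
  have hσinj : Function.Injective σ := fun a b h =>
    Sum.inl_injective (φ.injective (by rw [hσ, hσ, h]))
  have hσsurj : Function.Surjective σ := Finite.surjective_of_injective hσinj
  have hsize : ∀ v, fibreSize g (τ v) = fibreSize g v := by
    intro v
    refine (Finset.card_bij (fun u _ => σ u) ?_ (fun _ _ _ _ h => hσinj h) ?_).symm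
    · intro u hu
      simpa [← hcomm] using hu
    · intro u hu
      obtain ⟨x, rfl⟩ := hσsurj u
      exact ⟨x, by simpa [← hcomm] using hu, rfl⟩
  have hfτ : ∀ v, f (Sum.inr (τ v)) = f (Sum.inr v) := fun v => by rw [← hτ, hφ]
  have hfσ : ∀ u, f (Sum.inl (σ u)) = f (Sum.inl u) := fun u => by rw [← hσ, hφ]
  -- `τ v` and `v` share fibre size and label, so the hypothesis for that size class applies. Once
  -- `τ` is trivial, `σ` acts inside fibres.
  have hτid : ∀ v, τ v = v := by
    intro v
    rcases Nat.lt_or_ge (fibreSize g v) 2 with h | h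
    · rcases Nat.lt_or_ge (fibreSize g v) 1 with h0 | h1
      · exact hzero _ _ (by rw [hsize]; omega) (by omega) (hfτ v)
      · obtain ⟨u, rfl⟩ := (fibreSize_pos_iff g).1 h1
        have hgu : g (σ u) = τ (g u) := (hcomm u _).1 rfl
        rw [← hgu]
        refine hone _ _ ?_ (by omega) (hfσ u) ?_
        · rw [hgu, hsize]; omega
        · rw [hgu]; exact hfτ _
    · exact hlarge _ _ (by rwa [hsize]) h (hfτ v)
  rintro (u | v)
  · rw [hσ]
    refine congrArg _ (hfibre _ _ ?_ (hfσ u))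
    rw [(hcomm u _).1 rfl, hτid]
  · rw [hτ, hτid]

theorem exists_isDistinguishing {k : ℕ} {w : V} (hw : ∀ u, g u ≠ w)
    (hne : ∃ u u', g u ≠ g u') (h0 : Fintype.card V - #(imageSet g) ≤ k)
    (hl : maxFibreSize g ≤ k) (hm : singletonFibres g ≤ k * k) :
    ∃ f : V ⊕ V → Fin k, IsDistinguishing (functigraph (⊤ : SimpleGraph V) g) f := by
  have hk : 0 < k := by
    obtain ⟨u, -⟩ := hne
    exact lt_of_lt_of_le ((fibreSize_pos_iff g).2 ⟨u, rfl⟩) ((maxFibreSize_le_iff g).1 hl (g u))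
  have : Nonempty (Fin k) := ⟨⟨0, hk⟩⟩
  obtain ⟨a, ha⟩ := exists_injOn_of_card_le (β := Fin k) {v | fibreSize g v = 0}
    (by simpa [card_fibreSize_eq_zero] using h0)
  obtain ⟨p, hp⟩ := exists_injOn_of_card_le (β := Fin k × Fin k) {v | fibreSize g v = 1}
    (by simpa [← singletonFibres_eq] using hm)
  obtain ⟨b, hb⟩ := exists_injOn_of_card_le (β := Fin k) {v | 2 ≤ fibreSize g v} (by
    have := card_largeFibres_add_card_imageSet_le g
    rw [Fintype.card_fin]
    omega)
  have hc : ∀ v, ∃ c : V → Fin k, Set.InjOn c ({u | g u = v} : Finset V) := fun v =>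
    exists_injOn_of_card_le _ (by simpa [fibreSize] using (maxFibreSize_le_iff g).1 hl v)
  choose c hc using hc
  simp only [coe_filter, mem_univ, true_and, Set.InjOn, Set.mem_ofPred_eq] at ha hp hb hc
  -- A singleton fibre carries its pair `p v` split between the preimage and `v`; this is where `k *
  -- k` comes from.
  refine ⟨Sum.elim (fun u => if fibreSize g (g u) = 1 then (p (g u)).1 else c (g u) u)
    (fun v => if fibreSize g v = 0 then a v else if fibreSize g v = 1 then (p v).2 else b v),
    isDistinguishing_of_injOn hw hne ?_ ?_ ?_ ?_⟩
  · intro v v' hv hv' h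
    simp only [Sum.elim_inr, hv, hv', if_true] at h
    exact ha hv hv' h
  · intro u u' hu hu' h h'
    simp only [Sum.elim_inl, Sum.elim_inr, hu, hu', if_true, one_ne_zero, if_false] at h h'
    exact hp hu hu' (Prod.ext h h')
  · intro v v' hv hv' h
    have e0 : fibreSize g v ≠ 0 := by omega
    have e1 : fibreSize g v ≠ 1 := by omega
    have e0' : fibreSize g v' ≠ 0 := by omega
    have e1' : fibreSize g v' ≠ 1 := by omega
    simp only [Sum.elim_inr, e0, e1, e0', e1', if_false] at h
    exact hb hv hv' h
  · intro u u' hg h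
    by_cases h1 : fibreSize g (g u') = 1
    · exact eq_of_fibreSize_eq_one g h1 hg
    · simp only [Sum.elim_inl, hg, h1, if_false] at h
      exact hc (g u') hg rfl h

theorem distinguishingNumber_functigraph_top {w : V} (hw : ∀ u, g u ≠ w)
    (hne : ∃ u u', g u ≠ g u') :
    distinguishingNumber (functigraph (⊤ : SimpleGraph V) g) =
      max (max (Fintype.card V - #(imageSet g)) (maxFibreSize g)) (psi (singletonFibres g)) := by
  have hset : {t : ℕ | ∃ f : V ⊕ V → Fin t,
      IsDistinguishing (functigraph (⊤ : SimpleGraph V) g) f} =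
      Set.Ici (max (max (Fintype.card V - #(imageSet g)) (maxFibreSize g))
        (psi (singletonFibres g))) := by
    ext t
    simp only [Set.mem_ofPred_eq, Set.mem_Ici, max_le_iff, psi_le_iff]
    constructor
    · rintro ⟨f, hf⟩
      obtain ⟨h1, h2, h3⟩ := hf.bounds g
      exact ⟨⟨h1, h2⟩, h3⟩
    · rintro ⟨⟨h1, h2⟩, h3⟩
      exact exists_isDistinguishing hw hne h1 h2 h3
  rw [distinguishingNumber, hset, csInf_Ici]

end Counting

theorem theorem3p3 {V : Type*} [Fintype V] [DecidableEq V] (g : V → V) (n s l m : ℕ)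
    (hn : n = Fintype.card V) (hs : s = (imageSet g).card)
    (hl : l = maxFibreSize g) (hm : m = singletonFibres g)
    (hn3 : 3 ≤ n) (hs1 : 1 < s) (hsn : s ≤ n - 1) :
    (distinguishingNumber (functigraph (⊤ : SimpleGraph V) g) = n - s ∨
      distinguishingNumber (functigraph (⊤ : SimpleGraph V) g) = n - s + 1 ∨
      (2 ≤ m ∧ distinguishingNumber (functigraph (⊤ : SimpleGraph V) g) = psi m)) ∧
    (l = n - s + 1 →
      distinguishingNumber (functigraph (⊤ : SimpleGraph V) g) = max (n - s + 1) (psi m)) ∧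
    (l ≠ n - s + 1 →
      distinguishingNumber (functigraph (⊤ : SimpleGraph V) g) = max (n - s) (psi m)) := by
  have hV : Nonempty V := Fintype.card_pos_iff.1 (by omega)
  obtain ⟨w, hw⟩ : ∃ w, ∀ u, g u ≠ w := by
    obtain ⟨w, -, hw⟩ := Finset.exists_mem_notMem_of_card_lt_card
      (s := imageSet g) (t := univ) (by rw [card_univ]; omega)
    exact ⟨w, fun u hu => hw ((mem_imageSet g).2 ⟨u, hu⟩)⟩
  have hne : ∃ u u', g u ≠ g u' := by
    obtain ⟨x, hx, y, hy, hxy⟩ := Finset.one_lt_card.1 (hs ▸ hs1)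
    obtain ⟨u, rfl⟩ := (mem_imageSet g).1 hx
    obtain ⟨u', rfl⟩ := (mem_imageSet g).1 hy
    exact ⟨u, u', hxy⟩
  have hle := maxFibreSize_add_card_imageSet_le g
  -- Since `1 ≤ n - s`, `psi m` can exceed the other terms only if `2 ≤ m`.
  have hpsi : m < 2 → psi m ≤ 1 := fun h => (psi_le_iff m 1).2 (by omega)
  rw [distinguishingNumber_functigraph_top hw hne, ← hn, ← hs, ← hl, ← hm]
  rw [← hn, ← hs, ← hl] at hle
  refine ⟨?_, ?_, ?_⟩ <;> omega
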